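/- Let $1/2<H<1$ and $\gamma>0$, and let $Z=\{Z_t:t\ge 0\}$ be a fractional Brownian motion with Hurst parameter $H$, i.e. a centred Gaussian process with continuous paths and covariance $\mathbf E(Z_tZ_s)=\tfrac12\left(t^{2H}+s^{2H}-|t-s|^{2H}\right)$. Put $a_t:=H e^{t/H}$ for $t\in\mathbb R$, and let $$U^{(D,\gamma)}_t:=e^{-\gamma t}\int_{-\infty}^t e^{(\gamma-1)s}\,dZ_{a_s},\qquad t\in\mathbb R,$$ be the fractional Ornstein–Uhlenbeck process of the second kind, where the integral is the pathwise improper Riemann–Stieltjes integral $\lim_{T\to-\infty}\int_T^t e^{(\gamma-1)s}\,dZ_{a_s}$. Then, almost surely, these integrals exist for all $t\in\mathbb R$; the random variables $U^{(D,\gamma)}_t$ are square integrable with mean zero; and for all $t,s\in\mathbb R$ the covariance of $U^{(D,\gamma)}$ has the kernel representation $$\mathbf E\left(U^{(D,\gamma)}_tU^{(D,\gamma)}_s\right)=H(2H-1)\,H^{2H-2}\,e^{-\gamma(t+s)}\int_{-\infty}^{t}\int_{-\infty}^{s}\frac{e^{(\gamma-1+\frac1H)(u+v)}}{\left|e^{u/H}-e^{v/H}\right|^{2(1-H)}}\,dv\,du,$$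 where the double integral converges absolutely. -/

import Mathlib

open MeasureTheory ProbabilityTheory Filter Topology
open scoped NNReal

/-- `Z = (Z_t)_{t ≥ 0}` is a (standard) fractional Brownian motion with Hurst parameter `H` on the
probability space `(Ω, P)`: a centred Gaussian process with covariance
`E(Z_t Z_s) = (t^{2H} + s^{2H} - |t - s|^{2H}) / 2` and almost surely continuous paths. -/
structure IsFractionalBrownianMotion {Ω : Type*} [MeasurableSpace Ω] (H : ℝ) (Z : ℝ≥0 → Ω → ℝ)
    (P : Measure Ω) : Prop where
  gaussian : IsGaussianProcess Z P
  centered : ∀ t, ∫ ω, Z t ω ∂P = 0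
  covariance : ∀ t s : ℝ≥0, ∫ ω, Z t ω * Z s ω ∂P =
    1 / 2 * ((t : ℝ) ^ (2 * H) + (s : ℝ) ^ (2 * H) - |(t : ℝ) - (s : ℝ)| ^ (2 * H))
  continuous_paths : ∀ᵐ ω ∂P, Continuous fun t : ℝ≥0 => Z t ω

/-- For `a ≤ b`: the Riemann–Stieltjes integral `∫_a^b f dg` exists and equals `I`, that is, the
sums `∑ f(ξ_i) (g(x_{i+1}) - g(x_i))` over the tagged partitions
`a = x_0 ≤ ξ_0 ≤ x_1 ≤ ξ_1 ≤ ⋯ ≤ x_n = b` tend to `I` as the mesh tends to zero. -/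
def HasRiemannStieltjesIntegral (f g : ℝ → ℝ) (a b I : ℝ) : Prop :=
  ∀ ε : ℝ, 0 < ε → ∃ δ : ℝ, 0 < δ ∧ ∀ (n : ℕ) (x ξ : ℕ → ℝ), x 0 = a → x n = b →
    (∀ i < n, x i ≤ ξ i ∧ ξ i ≤ x (i + 1) ∧ x (i + 1) - x i < δ) →
      |∑ i ∈ Finset.range n, f (ξ i) * (g (x (i + 1)) - g (x i)) - I| < ε

/-- The improper Riemann–Stieltjes integral `∫_{-∞}^t f dg = lim_{T → -∞} ∫_T^t f dg` exists and
equals `L`. -/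
def HasImproperRSIntegral (f g : ℝ → ℝ) (t L : ℝ) : Prop :=
  ∃ J : ℝ → ℝ, (∀ T < t, HasRiemannStieltjesIntegral f g T t (J T)) ∧ Tendsto J atBot (𝓝 L)

open Classical in
/-- The value of `∫_{-∞}^t f dg` (and `0` if this improper integral does not exist). -/
noncomputable def improperRSIntegral (f g : ℝ → ℝ) (t : ℝ) : ℝ :=
  if h : ∃ L, HasImproperRSIntegral f g t L then h.choose else 0

/-- The time change `a_t = H e^{t/H}` (positive for `H > 0`). -/
noncomputable def fouTimeChange (H t : ℝ) : ℝ≥0 := (H * Real.exp (t / H)).toNNReal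

/-- The fractional Ornstein–Uhlenbeck process of the second kind driven by `Z`,
`U_t = e^{-γ t} ∫_{-∞}^t e^{(γ - 1) s} dZ_{a_s}`, the integral being pathwise. -/
noncomputable def fouSecondKind {Ω : Type*} (H γ : ℝ) (Z : ℝ≥0 → Ω → ℝ) (t : ℝ) (ω : Ω) : ℝ :=
  Real.exp (-γ * t) * improperRSIntegral (fun s => Real.exp ((γ - 1) * s))
    (fun s => Z (fouTimeChange H s) ω) t

/-- The kernel `e^{(γ - 1 + 1/H)(u + v)} / |e^{u/H} - e^{v/H}|^{2(1 - H)}`. -/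
noncomputable def fouKernel (H γ u v : ℝ) : ℝ :=
  Real.exp ((γ - 1 + 1 / H) * (u + v)) /
    |Real.exp (u / H) - Real.exp (v / H)| ^ (2 * (1 - H))

/-! Existence is pathwise. The integrand `e^{(γ-1)s}` is smooth, so integration by parts against a
continuous path leaves only the behaviour at `-∞`, where a bound `|Z_{a_s}| ≤ C e^{βs}` with `β > 1
- γ` suffices (`hasImproperRSIntegral_exp`). Every `β ∈ [0, 1)` is available: since `2H > 1`,
suitably weighted sums of squared dyadic increments have summable expectations, and chaining turns
this into a bound on the path (`ae_abs_le_exp`).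

The covariance is an isometry argument. Integrating the kernel with `γ = 1` twice gives back the
covariance of `Z_{a_p}` and `Z_{a_q}` (`integral_mul_fouTimeChange`), so `Z_{a_p} ↔ 1_{(-∞,p]}`
matches covariances with the form `∬ x(u) y(v) κ(u,v)`. By bilinearity the match extends to left
Riemann sums, and `integral_mul_eq_kernel_of_tendsto` carries it to limits: dominated convergence on
the plane makes the Gram matrix converge, hence the random variables converge in `L²`, necessarily
to their almost sure limit. This is applied twice, to the mesh and then to the lower endpoint.
Domination comes from `integrableOn_fouKernel`: up to the factor `e^{γ(u+v)}` the kernel is an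
integrable function of `u - v`. -/

/-! ### Riemann–Stieltjes integration by parts -/

/-- The error on one cell: splitting at the tag `ξ` rewrites it as `∫_x^ξ (g - g x) f' + ∫_ξ^y (g -
g y) f'`, which only sees the oscillation of `g`. -/
theorem abs_mul_sub_sub_integral_le {f f' g : ℝ → ℝ} (hf : ∀ x, HasDerivAt f (f' x) x)
    (hf' : Continuous f') (hg : Continuous g) {x ξ y η K : ℝ} (hxξ : x ≤ ξ) (hξy : ξ ≤ y)
    (hK : ∀ s ∈ Set.Icc x y, |f' s| ≤ K)
    (hη : ∀ s ∈ Set.Icc x y, |g s - g x| ≤ η ∧ |g s - g y| ≤ η) :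
    |f ξ * (g y - g x) - (f y * g y - f x * g x - ∫ s in x..y, g s * f' s)|
      ≤ η * K * (y - x) := by
  have hη0 : 0 ≤ η := (abs_nonneg _).trans (hη x ⟨le_rfl, hxξ.trans hξy⟩).1
  have hi : ∀ a b : ℝ, IntervalIntegrable (fun s => g s * f' s) volume a b := fun a b =>
    (hg.mul hf').intervalIntegrable a b
  have hc : ∀ c a b : ℝ, IntervalIntegrable (fun s => c * f' s) volume a b := fun c a b =>
    (continuous_const.mul hf').intervalIntegrable a b
  have hd : ∀ a b : ℝ, ∫ s in a..b, f' s = f b - f a := fun a b =>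
    intervalIntegral.integral_eq_sub_of_hasDerivAt (fun s _ => hf s) (hf'.intervalIntegrable a b)
  have h1 : ∫ s in x..ξ, (g s - g x) * f' s = (∫ s in x..ξ, g s * f' s) - g x * (f ξ - f x) := by
    simp_rw [sub_mul]
    rw [intervalIntegral.integral_sub (hi _ _) (hc _ _ _), intervalIntegral.integral_const_mul, hd]
  have h2 : ∫ s in ξ..y, (g s - g y) * f' s = (∫ s in ξ..y, g s * f' s) - g y * (f y - f ξ) := by
    simp_rw [sub_mul]
    rw [intervalIntegral.integral_sub (hi _ _) (hc _ _ _), intervalIntegral.integral_const_mul, hd]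
  have h3 := intervalIntegral.integral_add_adjacent_intervals (hi x ξ) (hi ξ y)
  have e : f ξ * (g y - g x) - (f y * g y - f x * g x - ∫ s in x..y, g s * f' s) =
      (∫ s in x..ξ, (g s - g x) * f' s) + ∫ s in ξ..y, (g s - g y) * f' s := by
    rw [h1, h2, ← h3]; ring
  have b1 : ‖∫ s in x..ξ, (g s - g x) * f' s‖ ≤ η * K * |ξ - x| := by
    refine intervalIntegral.norm_integral_le_of_norm_le_const fun s hs => ?_
    rw [Set.uIoc_of_le hxξ] at hs
    have hs' : s ∈ Set.Icc x y := ⟨hs.1.le, hs.2.trans hξy⟩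
    rw [Real.norm_eq_abs, abs_mul]
    exact mul_le_mul (hη s hs').1 (hK s hs') (abs_nonneg _) hη0
  have b2 : ‖∫ s in ξ..y, (g s - g y) * f' s‖ ≤ η * K * |y - ξ| := by
    refine intervalIntegral.norm_integral_le_of_norm_le_const fun s hs => ?_
    rw [Set.uIoc_of_le hξy] at hs
    have hs' : s ∈ Set.Icc x y := ⟨hxξ.trans hs.1.le, hs.2⟩
    rw [Real.norm_eq_abs, abs_mul]
    exact mul_le_mul (hη s hs').2 (hK s hs') (abs_nonneg _) hη0
  rw [abs_of_nonneg (by linarith), Real.norm_eq_abs] at b1 b2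
  rw [e]
  calc _ ≤ _ := abs_add_le _ _
    _ ≤ η * K * (ξ - x) + η * K * (y - ξ) := add_le_add b1 b2
    _ = _ := by ring

theorem mem_Icc_of_partition {a b : ℝ} {n : ℕ} {x : ℕ → ℝ} (h0 : x 0 = a) (hn : x n = b)
    (hx : ∀ i < n, x i ≤ x (i + 1)) : ∀ i ≤ n, x i ∈ Set.Icc a b := by
  have h1 : ∀ i ≤ n, a ≤ x i := by
    intro i
    induction i with
    | zero => intro _; exact h0.ge
    | succ i ih => intro hi; exact (ih (by omega)).trans (hx i (by omega))
  have h2 : ∀ j ≤ n, x (n - j) ≤ b := by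
    intro j
    induction j with
    | zero => intro _; exact hn.le
    | succ j ih =>
      intro hj
      have := hx (n - (j + 1)) (by omega)
      rw [show n - (j + 1) + 1 = n - j by omega] at this
      exact this.trans (ih (by omega))
  intro i hi
  refine ⟨h1 i hi, ?_⟩
  have := h2 (n - i) (by omega)
  rwa [show n - (n - i) = i by omega] at this

/-- Integration by parts: a `C¹` integrand is Riemann–Stieltjes integrable against a continuous
integrator. -/
theorem hasRiemannStieltjesIntegral_of_hasDerivAt {f f' g : ℝ → ℝ}
    (hf : ∀ x, HasDerivAt f (f' x) x) (hf' : Continuous f') (hg : Continuous g) {a b : ℝ}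
    (hab : a ≤ b) :
    HasRiemannStieltjesIntegral f g a b
      (f b * g b - f a * g a - ∫ s in a..b, g s * f' s) := by
  intro ε hε
  obtain ⟨K, hK⟩ := isCompact_Icc.exists_bound_of_continuousOn (s := Set.Icc a b)
    hf'.continuousOn
  have hK0 : 0 ≤ K := (norm_nonneg _).trans (hK a ⟨le_rfl, hab⟩)
  have hba : 0 ≤ b - a := sub_nonneg.2 hab
  -- The total error is at most `η K (b - a)`; the added ones keep `η` defined and the final
  -- inequality strict when `K` or `b - a` vanishes.
  set η := ε / ((K + 1) * (b - a + 1)) with hηdef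
  have hη : 0 < η := by positivity
  obtain ⟨δ, hδ, hgδ⟩ := Metric.uniformContinuousOn_iff.1
    (isCompact_Icc.uniformContinuousOn_of_continuous (s := Set.Icc a b) hg.continuousOn) η hη
  refine ⟨δ, hδ, fun n x ξ h0 hn hx => ?_⟩
  have hmem := mem_Icc_of_partition h0 hn fun i hi => (hx i hi).1.trans (hx i hi).2.1
  have hi : ∀ a b : ℝ, IntervalIntegrable (fun s => g s * f' s) volume a b := fun a b =>
    (hg.mul hf').intervalIntegrable a b
  have htel : f b * g b - f a * g a - ∫ s in a..b, g s * f' s =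
      ∑ i ∈ Finset.range n, (f (x (i + 1)) * g (x (i + 1)) - f (x i) * g (x i) -
        ∫ s in x i..x (i + 1), g s * f' s) := by
    rw [Finset.sum_sub_distrib, Finset.sum_range_sub (fun i => f (x i) * g (x i)),
      intervalIntegral.sum_integral_adjacent_intervals (fun k _ => hi _ _), h0, hn]
  rw [htel, ← Finset.sum_sub_distrib]
  calc _ ≤ _ := Finset.abs_sum_le_sum_abs _ _
    _ ≤ ∑ i ∈ Finset.range n, η * K * (x (i + 1) - x i) := by
      refine Finset.sum_le_sum fun i hi => ?_
      have hin := Finset.mem_range.1 hi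
      obtain ⟨h1, h2, h3⟩ := hx i hin
      have m1 := hmem i hin.le
      have m2 := hmem (i + 1) hin
      refine abs_mul_sub_sub_integral_le hf hf' hg h1 h2
        (fun s hs => hK s ⟨m1.1.trans hs.1, hs.2.trans m2.2⟩) fun s hs => ?_
      have ms : s ∈ Set.Icc a b := ⟨m1.1.trans hs.1, hs.2.trans m2.2⟩
      refine ⟨(hgδ s ms _ m1 ?_).le, (hgδ s ms _ m2 ?_).le⟩ <;>
      · rw [Real.dist_eq, abs_lt]; constructor <;> linarith [hs.1, hs.2]
    _ = η * K * (b - a) := by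
      rw [← Finset.mul_sum, Finset.sum_range_sub x, h0, hn]
    _ < ε := by
      rw [hηdef, div_mul_eq_mul_div, div_mul_eq_mul_div, div_lt_iff₀ (by positivity)]
      nlinarith [mul_nonneg hK0 hba]

/-! ### Uniform left sums and improper integrals -/

/-- The `i`-th point of the partition of `[a, b]` into `n` equal parts. -/
noncomputable def uniformPartition (a b : ℝ) (n i : ℕ) : ℝ := a + i * ((b - a) / n)

theorem uniformPartition_zero (a b : ℝ) (n : ℕ) : uniformPartition a b n 0 = a := by
  simp [uniformPartition]

theorem uniformPartition_self (a b : ℝ) {n : ℕ} (hn : n ≠ 0) : uniformPartition a b n n = b := by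
  have : (n : ℝ) ≠ 0 := by exact_mod_cast hn
  simp only [uniformPartition]; field_simp; ring

theorem uniformPartition_succ_sub (a b : ℝ) (n i : ℕ) :
    uniformPartition a b n (i + 1) - uniformPartition a b n i = (b - a) / n := by
  simp only [uniformPartition]; push_cast; ring

theorem uniformPartition_mono {a b : ℝ} (hab : a ≤ b) (n i : ℕ) :
    uniformPartition a b n i ≤ uniformPartition a b n (i + 1) := by
  have := uniformPartition_succ_sub a b n i
  have h : 0 ≤ (b - a) / n := div_nonneg (sub_nonneg.2 hab) (Nat.cast_nonneg n)
  linarith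

/-- The Riemann–Stieltjes sum of `f dg` over the uniform partition with `n` cells, tagged on the
left. -/
noncomputable def leftSum (f g : ℝ → ℝ) (a b : ℝ) (n : ℕ) : ℝ :=
  ∑ i ∈ Finset.range n, f (uniformPartition a b n i) *
    (g (uniformPartition a b n (i + 1)) - g (uniformPartition a b n i))

theorem HasRiemannStieltjesIntegral.tendsto_leftSum {f g : ℝ → ℝ} {a b I : ℝ} (hab : a ≤ b)
    (h : HasRiemannStieltjesIntegral f g a b I) :
    Tendsto (leftSum f g a b) atTop (𝓝 I) := by
  rw [Metric.tendsto_atTop]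
  intro ε hε
  obtain ⟨δ, hδ, H⟩ := h ε hε
  have ht : Tendsto (fun n : ℕ => (b - a) / n) atTop (𝓝 0) :=
    tendsto_const_div_atTop_nhds_zero_nat _
  obtain ⟨N, hN⟩ := eventually_atTop.1 (ht.eventually_lt_const hδ)
  -- `n = 0` has to be avoided: with no cells the partition does not reach `b`.
  refine ⟨N + 1, fun n hn => ?_⟩
  refine H n _ _ (uniformPartition_zero a b n) (uniformPartition_self a b (by omega))
    fun i _ => ⟨le_rfl, uniformPartition_mono hab n i, ?_⟩
  rw [uniformPartition_succ_sub]
  exact hN n (by omega)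

theorem HasImproperRSIntegral.unique {f g : ℝ → ℝ} {t L L' : ℝ}
    (h : HasImproperRSIntegral f g t L) (h' : HasImproperRSIntegral f g t L') : L = L' := by
  obtain ⟨J, hJ, hL⟩ := h
  obtain ⟨J', hJ', hL'⟩ := h'
  refine tendsto_nhds_unique (hL.congr' ?_) hL'
  filter_upwards [Iio_mem_atBot t] with T hT
  exact tendsto_nhds_unique ((hJ T hT).tendsto_leftSum (le_of_lt hT))
    ((hJ' T hT).tendsto_leftSum (le_of_lt hT))

theorem HasImproperRSIntegral.improperRSIntegral_eq {f g : ℝ → ℝ} {t L : ℝ}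
    (h : HasImproperRSIntegral f g t L) : improperRSIntegral f g t = L := by
  have hex : ∃ L, HasImproperRSIntegral f g t L := ⟨L, h⟩
  rw [improperRSIntegral, dif_pos hex]
  exact hex.choose_spec.unique h

/-- After integration by parts, both the boundary term at `T` and the remaining integrand are
`O(e^{(c+β)s})` at `-∞`; the sign of `c` plays no role. -/
theorem hasImproperRSIntegral_exp {g : ℝ → ℝ} (hg : Continuous g) {c β C : ℝ} (hcβ : 0 < c + β)
    (hC : ∀ s ≤ 0, |g s| ≤ C * Real.exp (β * s)) (t : ℝ) :
    HasImproperRSIntegral (fun s => Real.exp (c * s)) g t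
      (Real.exp (c * t) * g t - ∫ s in Set.Iic t, g s * (Real.exp (c * s) * c)) := by
  have hd : ∀ x, HasDerivAt (fun s => Real.exp (c * s)) (Real.exp (c * x) * c) x := fun x => by
    simpa using ((hasDerivAt_id x).const_mul c).exp
  have hd' : Continuous fun s => Real.exp (c * s) * c := by fun_prop
  refine ⟨fun T => Real.exp (c * t) * g t - Real.exp (c * T) * g T -
    ∫ s in T..t, g s * (Real.exp (c * s) * c),
    fun T hT => hasRiemannStieltjesIntegral_of_hasDerivAt hd hd' hg hT.le, ?_⟩
  have hexp : ∀ s ≤ 0, |Real.exp (c * s) * g s| ≤ C * Real.exp ((c + β) * s) := fun s hs => by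
    rw [abs_mul, abs_of_pos (Real.exp_pos _), add_mul, Real.exp_add]
    nlinarith [hC s hs, Real.exp_pos (c * s)]
  have hcont : Continuous fun s => g s * (Real.exp (c * s) * c) := hg.mul hd'
  have hint0 : IntegrableOn (fun s => g s * (Real.exp (c * s) * c)) (Set.Iic 0) := by
    refine Integrable.mono' (((integrableOn_exp_mul_Iic hcβ 0).const_mul C).mul_const |c|)
      hcont.aestronglyMeasurable ?_
    refine (ae_restrict_iff' measurableSet_Iic).2 (ae_of_all _ fun s hs => ?_)
    rw [Real.norm_eq_abs, show g s * (Real.exp (c * s) * c) = Real.exp (c * s) * g s * c by ring,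
      abs_mul]
    exact mul_le_mul_of_nonneg_right (hexp s hs) (abs_nonneg c)
  have hint : IntegrableOn (fun s => g s * (Real.exp (c * s) * c)) (Set.Iic t) := by
    refine (hint0.union (hcont.integrableOn_Icc (a := 0) (b := t))).mono_set fun s hs => ?_
    by_cases h : s ≤ 0
    · exact Or.inl h
    · exact Or.inr ⟨le_of_not_ge h, hs⟩
  have h0 : Tendsto (fun T => Real.exp (c * T) * g T) atBot (𝓝 0) := by
    have : Tendsto (fun T => C * Real.exp ((c + β) * T)) atBot (𝓝 (C * 0)) :=
      (Real.tendsto_exp_atBot.comp (tendsto_id.const_mul_atBot hcβ)).const_mul C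
    rw [mul_zero] at this
    refine squeeze_zero_norm' ?_ this
    filter_upwards [Iic_mem_atBot 0] with T hT using hexp T hT
  have h1 := intervalIntegral_tendsto_integral_Iic t hint tendsto_id
  simpa using (tendsto_const_nhds.sub h0).sub h1

/-! ### Decay of the paths at time zero -/

theorem ae_bddAbove_of_summable_integral {Ω ι : Type*} [MeasurableSpace Ω] [Countable ι]
    {P : Measure Ω} {X : ι → Ω → ℝ} (hX : ∀ i, Integrable (X i) P) (h0 : ∀ i ω, 0 ≤ X i ω)
    (hs : Summable fun i => ∫ ω, X i ω ∂P) : ∀ᵐ ω ∂P, ∃ G, ∀ i, X i ω ≤ G := by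
  have hm : ∀ i, AEMeasurable (fun ω => ENNReal.ofReal (X i ω)) P := fun i =>
    (hX i).aemeasurable.ennreal_ofReal
  have h1 : ∫⁻ ω, ∑' i, ENNReal.ofReal (X i ω) ∂P ≠ ⊤ := by
    rw [lintegral_tsum hm]
    simp_rw [← ofReal_integral_eq_lintegral_ofReal (hX _) (ae_of_all _ (h0 _))]
    rw [← ENNReal.ofReal_tsum_of_nonneg (fun i => integral_nonneg (h0 i)) hs]
    exact ENNReal.ofReal_ne_top
  filter_upwards [ae_lt_top' (AEMeasurable.tsum hm) h1] with ω hω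
  refine ⟨(∑' i, ENNReal.ofReal (X i ω)).toReal, fun i => ?_⟩
  rw [← ENNReal.ofReal_le_iff_le_toReal hω.ne]
  exact ENNReal.le_tsum i

/-- Chaining along dyadic points: geometric control of the dyadic increments of a continuous
function bounds the function. -/
theorem abs_le_of_dyadic_increments {z : ℝ → ℝ} (hz : Continuous z) (hz0 : z 0 = 0) {A C r : ℝ}
    (hA : 0 < A) (hC : 0 ≤ C) (hr0 : 0 ≤ r) (hr1 : r < 1)
    (h : ∀ n k : ℕ, k < 2 ^ n →
      |z (A * ((k + 1 : ℕ) / 2 ^ n)) - z (A * (k / 2 ^ n))| ≤ C * r ^ n)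
    {t : ℝ} (ht : t ∈ Set.Icc 0 A) : |z t| ≤ C / (1 - r) := by
  -- An even point of level `n + 1` already belongs to level `n`, and an odd one is a single
  -- increment away from such a point, so each level costs one term `C r^j`.
  have key : ∀ n k : ℕ, k ≤ 2 ^ n →
      |z (A * (k / 2 ^ n))| ≤ C * ∑ j ∈ Finset.range (n + 1), r ^ j := by
    intro n
    induction n with
    | zero =>
      intro k hk
      have hk' : k = 0 ∨ k = 1 := by rw [pow_zero] at hk; omega
      rcases hk' with rfl | rfl
      · simpa [hz0] using hC
      · have := h 0 0 (by norm_num)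
        simpa [hz0] using this
    | succ n ih =>
      intro k hk
      have hdouble : ∀ j : ℕ, A * (((2 * j : ℕ) : ℝ) / 2 ^ (n + 1)) = A * (j / 2 ^ n) := by
        intro j; push_cast; rw [pow_succ]; field_simp
      rw [pow_succ] at hk
      rw [Finset.sum_range_succ, mul_add]
      have hpos : 0 ≤ C * r ^ (n + 1) := by positivity
      rcases Nat.even_or_odd' k with ⟨j, rfl | rfl⟩
      · rw [hdouble]
        exact (ih j (by omega)).trans (le_add_of_nonneg_right hpos)
      · have h1 := h (n + 1) (2 * j) (by rw [pow_succ]; omega)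
        rw [hdouble] at h1
        have h2 := ih j (by omega)
        have h3 := abs_add_le (z (A * (j / 2 ^ n)))
          (z (A * ((2 * j + 1 : ℕ) / 2 ^ (n + 1))) - z (A * (j / 2 ^ n)))
        rw [add_sub_cancel] at h3
        linarith
  have hsum : ∀ n : ℕ, ∑ j ∈ Finset.range (n + 1), r ^ j ≤ (1 - r)⁻¹ := fun n => by
    rw [← tsum_geometric_of_lt_one hr0 hr1]
    exact (summable_geometric_of_lt_one hr0 hr1).sum_le_tsum _ fun i _ => by positivity
  have hx : 0 ≤ t / A := div_nonneg ht.1 hA.le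
  have hlim : Tendsto (fun n : ℕ => A * ((⌊t / A * 2 ^ n⌋₊ : ℝ) / 2 ^ n)) atTop (𝓝 t) := by
    have h1 := ((tendsto_nat_floor_mul_div_atTop hx).comp
      (tendsto_pow_atTop_atTop_of_one_lt (one_lt_two (α := ℝ)))).const_mul A
    rwa [mul_div_cancel₀ _ hA.ne'] at h1
  refine le_of_tendsto ((hz.tendsto t).comp hlim).abs (Eventually.of_forall fun n => ?_)
  have hk : ⌊t / A * 2 ^ n⌋₊ ≤ 2 ^ n := by
    refine Nat.floor_le_of_le ?_
    push_cast
    exact mul_le_of_le_one_left (by positivity) ((div_le_one hA).2 ht.2)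
  calc _ ≤ _ := key n _ hk
    _ ≤ C * (1 - r)⁻¹ := mul_le_mul_of_nonneg_left (hsum n) hC
    _ = _ := (div_eq_mul_inv _ _).symm

namespace IsFractionalBrownianMotion

variable {Ω : Type*} [MeasurableSpace Ω] {P : Measure Ω} {H : ℝ} {Z : ℝ≥0 → Ω → ℝ}

theorem memLp_two (hZ : IsFractionalBrownianMotion H Z P) (t : ℝ≥0) : MemLp (Z t) 2 P :=
  (hZ.gaussian.hasGaussianLaw_eval t).memLp_two

theorem integral_sq_sub (hZ : IsFractionalBrownianMotion H Z P) (hH : 0 < H) (t s : ℝ≥0) :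
    ∫ ω, (Z t ω - Z s ω) ^ 2 ∂P = |(t : ℝ) - s| ^ (2 * H) := by
  have h : ∀ u v : ℝ≥0, Integrable (fun ω => Z u ω * Z v ω) P := fun u v =>
    (hZ.memLp_two u).integrable_mul (hZ.memLp_two v)
  have e : ∀ ω, (Z t ω - Z s ω) ^ 2 = Z t ω * Z t ω - 2 * (Z t ω * Z s ω) + Z s ω * Z s ω :=
    fun ω => by ring
  have i1 : Integrable (fun ω => Z t ω * Z t ω - 2 * (Z t ω * Z s ω)) P :=
    (h t t).sub ((h t s).const_mul 2)
  simp_rw [e]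
  rw [integral_add i1 (h s s),
    integral_sub (h t t) ((h t s).const_mul 2), integral_const_mul, hZ.covariance, hZ.covariance,
    hZ.covariance]
  have : (0 : ℝ) ^ (2 * H) = 0 := Real.zero_rpow (by positivity)
  simp only [sub_self, abs_zero, this]
  ring

theorem ae_eq_zero (hZ : IsFractionalBrownianMotion H Z P) (hH : 0 < H) :
    ∀ᵐ ω ∂P, Z 0 ω = 0 := by
  have h1 : ∫ ω, Z 0 ω * Z 0 ω ∂P = 0 := by
    rw [hZ.covariance]
    simp [Real.zero_rpow (show 2 * H ≠ 0 by positivity)]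
  have h2 := (integral_eq_zero_iff_of_nonneg (fun ω => mul_self_nonneg (Z 0 ω))
    ((hZ.memLp_two 0).integrable_mul (hZ.memLp_two 0))).1 h1
  filter_upwards [h2] with ω hω using mul_self_eq_zero.1 hω

/-- Almost surely `|Z_t| = O(t^{βH})` at `0`, expressed in the time scale `t = H e^{s/H}`. -/
theorem ae_abs_le_exp (hZ : IsFractionalBrownianMotion H Z P) (hH : 1 / 2 < H) {β : ℝ}
    (hβ0 : 0 ≤ β) (hβ1 : β < 1) :
    ∀ᵐ ω ∂P, ∃ C, ∀ s ≤ 0, |Z (fouTimeChange H s) ω| ≤ C * Real.exp (β * s) := by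
  have hH0 : 0 < H := by linarith
  -- The `2^n` squared increments of level `n` on `[0, A m]` have total expectation `(A m)^{2H}
  -- r^{4n}`. Dividing by `(l m n)^2` spends `r^{2n}` and `e^{-2βm}`, leaving `r^{2n}` and `ρ^m`,
  -- both summable.
  set r : ℝ := 2 ^ ((1 - 2 * H) / 4) with hr
  have hr0 : 0 < r := by positivity
  have hr1 : r < 1 := Real.rpow_lt_one_of_one_lt_of_neg one_lt_two (by linarith)
  have hr4 : r ^ 4 = 2 * 2 ^ (-(2 * H)) := by
    rw [hr, ← Real.rpow_natCast, ← Real.rpow_mul two_pos.le, ← Real.rpow_one_add' two_pos.le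
      (by linarith)]
    congr 1; push_cast; ring
  set ρ : ℝ := Real.exp (-(2 * (1 - β))) with hρ
  have hρ1 : ρ < 1 := (Real.exp_lt_exp.2 (by linarith)).trans_eq Real.exp_zero
  set A : ℕ → ℝ := fun m => H * Real.exp (-m / H) with hAdef
  have hA : ∀ m, 0 < A m := fun m => by positivity
  set l : ℕ → ℕ → ℝ := fun m n => Real.exp (-(β * m)) * r ^ n with hl
  have hl0 : ∀ m n, 0 < l m n := fun m n => by positivity
  set D : ℕ → ℕ → ℕ → Ω → ℝ := fun m n k ω =>
    Z (A m * ((k + 1 : ℕ) / 2 ^ n)).toNNReal ω - Z (A m * (k / 2 ^ n)).toNNReal ω with hD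
  set X : ℕ × ℕ → Ω → ℝ := fun i ω =>
    ∑ k ∈ Finset.range (2 ^ i.2), (D i.1 i.2 k ω) ^ 2 / (l i.1 i.2) ^ 2 with hX
  have hDi : ∀ m n k, Integrable (fun ω => (D m n k ω) ^ 2 / (l m n) ^ 2) P := fun m n k =>
    ((hZ.memLp_two _).sub (hZ.memLp_two _)).integrable_sq.div_const _
  have hED : ∀ m n k, ∫ ω, (D m n k ω) ^ 2 ∂P = (A m / 2 ^ n) ^ (2 * H) := fun m n k => by
    rw [hZ.integral_sq_sub hH0, Real.coe_toNNReal _ (by have := hA m; positivity),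
      Real.coe_toNNReal _ (by have := hA m; positivity)]
    congr 1
    rw [show A m * (((k + 1 : ℕ) : ℝ) / 2 ^ n) - A m * (k / 2 ^ n) = A m / 2 ^ n by
      push_cast; ring, abs_of_pos (by have := hA m; positivity)]
  have hEX : ∀ i, ∫ ω, X i ω ∂P = H ^ (2 * H) * (ρ ^ i.1 * (r ^ 2) ^ i.2) := by
    rintro ⟨m, n⟩
    simp only [hX]
    rw [integral_finsetSum _ fun k _ => hDi m n k]
    simp_rw [integral_div, hED]
    rw [Finset.sum_const, Finset.card_range, nsmul_eq_mul, Real.div_rpow (hA m).le (by positivity)]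
    have e1 : A m ^ (2 * H) = H ^ (2 * H) * Real.exp (-(2 * m)) := by
      simp only [hAdef]
      rw [Real.mul_rpow hH0.le (Real.exp_pos _).le, ← Real.exp_mul]
      congr 2; field_simp
    have e2 : ((2 : ℝ) ^ n) ^ (2 * H) = ((2 : ℝ) ^ (2 * H)) ^ n := by
      rw [← Real.rpow_natCast, ← Real.rpow_mul two_pos.le, ← Real.rpow_natCast,
        ← Real.rpow_mul two_pos.le, mul_comm]
    have e3 : ρ ^ m * Real.exp (-(β * m)) ^ 2 = Real.exp (-(2 * m)) := by
      rw [hρ, ← Real.exp_nat_mul, ← Real.exp_nat_mul, ← Real.exp_add]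
      congr 1; push_cast; ring
    have e4 : (2 : ℝ) ^ n = (r ^ 4) ^ n * ((2 : ℝ) ^ (2 * H)) ^ n := by
      rw [hr4, Real.rpow_neg two_pos.le, ← mul_pow]
      congr 1; field_simp
    rw [e1, e2]
    simp only [hl]
    push_cast
    rw [← e3, e4]
    field_simp
    ring
  have hsum : Summable fun i => ∫ ω, X i ω ∂P := by
    simp_rw [hEX]
    refine Summable.mul_left _ ?_
    exact (summable_geometric_of_lt_one (Real.exp_pos _).le hρ1).mul_of_nonneg
      (summable_geometric_of_lt_one (sq_nonneg r) (by nlinarith))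
      (fun m => by positivity) (fun n => by positivity)
  have hbdd := ae_bddAbove_of_summable_integral
    (fun i => integrable_finsetSum _ fun k _ => hDi i.1 i.2 k)
    (fun i ω => Finset.sum_nonneg fun k _ => by positivity) hsum
  filter_upwards [hbdd, hZ.ae_eq_zero hH0, hZ.continuous_paths] with ω ⟨G, hG⟩ h0 hc
  have hGD : ∀ m n k : ℕ, k < 2 ^ n → |D m n k ω| ≤ Real.sqrt G * Real.exp (-(β * m)) * r ^ n := by
    intro m n k hk
    have h1 : (D m n k ω) ^ 2 / (l m n) ^ 2 ≤ G :=
      (Finset.single_le_sum (f := fun k => (D m n k ω) ^ 2 / (l m n) ^ 2)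
        (fun k _ => by positivity) (Finset.mem_range.2 hk)).trans (hG (m, n))
    rw [← div_pow] at h1
    have h2 := Real.abs_le_sqrt h1
    rw [abs_div, abs_of_pos (hl0 m n), div_le_iff₀ (hl0 m n)] at h2
    rw [mul_assoc]; exact h2
  refine ⟨Real.sqrt G * Real.exp β / (1 - r), fun s hs => ?_⟩
  -- Then `a_s ≤ A m`, and `-s < m + 1` gives `e^{-βm} ≤ e^β e^{βs}`, whence the factor `e^β` in the
  -- constant.
  set m := ⌊-s⌋₊ with hm
  have hm1 : (m : ℝ) ≤ -s := Nat.floor_le (by linarith)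
  have hm2 : -s < m + 1 := Nat.lt_floor_add_one _
  have hz : Continuous fun t : ℝ => Z t.toNNReal ω := hc.comp continuous_real_toNNReal
  have hmem : H * Real.exp (s / H) ∈ Set.Icc 0 (A m) := by
    refine ⟨by positivity, mul_le_mul_of_nonneg_left (Real.exp_le_exp.2 ?_) hH0.le⟩
    gcongr; linarith
  have := abs_le_of_dyadic_increments hz (by simpa using h0) (hA m)
    (C := Real.sqrt G * Real.exp (-(β * m))) (by positivity) hr0.le hr1
    (fun n k hk => hGD m n k hk) hmem
  refine this.trans ?_
  rw [div_mul_eq_mul_div]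
  have h1r : 0 < 1 - r := by linarith
  refine div_le_div_of_nonneg_right ?_ h1r.le
  rw [mul_assoc, ← Real.exp_add]
  refine mul_le_mul_of_nonneg_left (Real.exp_le_exp.2 ?_) (Real.sqrt_nonneg G)
  nlinarith

end IsFractionalBrownianMotion

/-! ### Factorization and integrability of the kernel -/

/-- The translation-invariant factor `|2 sinh (w / 2H)|^{2H - 2}` of the kernel. -/
noncomputable def sinhKernel (H w : ℝ) : ℝ := |2 * Real.sinh (w / (2 * H))| ^ (2 * H - 2)

theorem sinhKernel_nonneg (H w : ℝ) : 0 ≤ sinhKernel H w := Real.rpow_nonneg (abs_nonneg _) _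

theorem sinhKernel_neg (H w : ℝ) : sinhKernel H (-w) = sinhKernel H w := by
  simp only [sinhKernel]
  rw [neg_div, Real.sinh_neg, mul_neg, abs_neg]

theorem measurable_sinhKernel (H : ℝ) : Measurable (sinhKernel H) := by
  unfold sinhKernel
  have : Measurable fun w : ℝ => |2 * Real.sinh (w / (2 * H))| :=
    (Continuous.abs (by fun_prop)).measurable
  exact this.pow_const _

/-- Near `0` the function is dominated by a multiple of `w^{2H-2}`, with exponent above `-1` because
`H > 1/2`. For `w > 1`, `2 sinh (w/2H) ≥ (1 - e^{-1/H}) e^{w/2H}`, and `H < 1` turns this into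
exponential decay. Evenness covers the negative axis. -/
theorem integrable_sinhKernel {H : ℝ} (hH : 1 / 2 < H) (hH1 : H < 1) :
    Integrable (sinhKernel H) := by
  have hH0 : 0 < H := by linarith
  have hm := (measurable_sinhKernel H).aestronglyMeasurable (μ := (volume : Measure ℝ))
  have h1 : IntegrableOn (sinhKernel H) (Set.Ioc 0 1) := by
    have hi : IntegrableOn (fun w : ℝ => w ^ (2 * H - 2)) (Set.Ioc 0 1) :=
      (intervalIntegrable_iff_integrableOn_Ioc_of_le zero_le_one).1
        (intervalIntegral.intervalIntegrable_rpow' (by linarith))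
    refine Integrable.mono' (hi.mul_const ((H⁻¹) ^ (2 * H - 2))) hm.restrict ?_
    refine (ae_restrict_iff' measurableSet_Ioc).2 (ae_of_all _ fun w hw => ?_)
    rw [Real.norm_eq_abs, abs_of_nonneg (sinhKernel_nonneg H w),
      ← Real.mul_rpow hw.1.le (by positivity)]
    have hw0 := hw.1
    refine Real.rpow_le_rpow_of_nonpos (by positivity) ?_ (by linarith)
    have h2 : w / (2 * H) ≤ Real.sinh (w / (2 * H)) := Real.self_le_sinh_iff.2 (by positivity)
    calc w * H⁻¹ = 2 * (w / (2 * H)) := by field_simp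
      _ ≤ 2 * Real.sinh (w / (2 * H)) := by linarith
      _ ≤ _ := le_abs_self _
  have h2 : IntegrableOn (sinhKernel H) (Set.Ioi 1) := by
    have hi : IntegrableOn (fun w : ℝ => Real.exp ((2 * H - 2) / (2 * H) * w)) (Set.Ioi 1) :=
      integrableOn_exp_mul_Ioi (div_neg_of_neg_of_pos (by linarith) (by linarith)) 1
    set c : ℝ := 1 - Real.exp (-(1 / H)) with hc
    have hc0 : 0 < c := sub_pos.2 ((Real.exp_lt_exp.2 (by
      have : 0 < 1 / H := by positivity
      linarith)).trans_eq Real.exp_zero)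
    refine Integrable.mono' (hi.const_mul (c ^ (2 * H - 2))) hm.restrict ?_
    refine (ae_restrict_iff' measurableSet_Ioi).2 (ae_of_all _ fun w hw => ?_)
    rw [Real.norm_eq_abs, abs_of_nonneg (sinhKernel_nonneg H w),
      show (2 * H - 2) / (2 * H) * w = w / (2 * H) * (2 * H - 2) by ring, Real.exp_mul,
      ← Real.mul_rpow hc0.le (Real.exp_pos _).le]
    refine Real.rpow_le_rpow_of_nonpos (by positivity) ?_ (by linarith)
    refine le_trans ?_ (le_abs_self _)
    rw [Real.sinh_eq, mul_div_cancel₀ _ two_ne_zero, hc, sub_mul, one_mul, ← Real.exp_add]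
    have : -(w / (2 * H)) ≤ -(1 / H) + w / (2 * H) := by
      have hw1 : (1 : ℝ) < w := hw
      have : 1 / H ≤ w / H := by gcongr
      have e : w / H = w / (2 * H) + w / (2 * H) := by field_simp; ring
      linarith
    have := Real.exp_le_exp.2 this
    linarith
  have h3 : IntegrableOn (sinhKernel H) (Set.Ioi 0) := by
    rw [← Set.Ioc_union_Ioi_eq_Ioi zero_le_one]; exact h1.union h2
  have h4 : IntegrableOn (sinhKernel H) (Set.Iic 0) := by
    have := IntegrableOn.comp_neg_Iic (c := 0) (f := sinhKernel H)
      (by rw [neg_zero]; exact (integrableOn_Ici_iff_integrableOn_Ioi (by simp)).2 h3)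
    simpa only [sinhKernel_neg] using this
  rw [← integrableOn_univ, ← Set.Iic_union_Ioi (a := (0 : ℝ))]
  exact h4.union h3

theorem fouKernel_eq_exp_mul_sinhKernel {H : ℝ} (hH : 0 < H) (γ u v : ℝ) :
    fouKernel H γ u v = Real.exp (γ * u) * Real.exp (γ * v) * sinhKernel H (u - v) := by
  have e : Real.exp (u / H) - Real.exp (v / H) =
      Real.exp ((u + v) / (2 * H)) * (2 * Real.sinh ((u - v) / (2 * H))) := by
    rw [Real.sinh_eq, mul_div_cancel₀ _ two_ne_zero, mul_sub, ← Real.exp_add, ← Real.exp_add]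
    congr 2 <;> field_simp <;> ring
  rw [fouKernel, sinhKernel, e, abs_mul, abs_of_pos (Real.exp_pos _), div_eq_mul_inv,
    ← Real.rpow_neg (by positivity), Real.mul_rpow (Real.exp_pos _).le (abs_nonneg _),
    ← Real.exp_mul, ← mul_assoc, ← Real.exp_add, ← Real.exp_add,
    show -(2 * (1 - H)) = 2 * H - 2 by ring]
  congr 2
  field_simp
  ring

theorem fouKernel_nonneg (H γ u v : ℝ) : 0 ≤ fouKernel H γ u v := by
  unfold fouKernel; positivity

theorem measurable_fouKernel (H γ : ℝ) : Measurable fun p : ℝ × ℝ => fouKernel H γ p.1 p.2 := by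
  unfold fouKernel
  have h1 : Measurable fun p : ℝ × ℝ => |Real.exp (p.1 / H) - Real.exp (p.2 / H)| :=
    (Continuous.abs (by fun_prop)).measurable
  have h2 : Measurable fun p : ℝ × ℝ => Real.exp ((γ - 1 + 1 / H) * (p.1 + p.2)) :=
    Continuous.measurable (by fun_prop)
  exact h2.div (h1.pow_const _)

/-- Bounding `e^{γu}` by `e^{γt}` leaves the convolution integrand of two integrable functions,
`1_{v ≤ s} e^{γv}` and `sinhKernel H`. -/
theorem integrableOn_fouKernel {H γ : ℝ} (hH : 1 / 2 < H) (hH1 : H < 1) (hγ : 0 < γ) (t s : ℝ) :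
    IntegrableOn (fun p : ℝ × ℝ => fouKernel H γ p.1 p.2) (Set.Iic t ×ˢ Set.Iic s) := by
  have h1 : Integrable ((Set.Iic s).indicator fun v => Real.exp (γ * v)) :=
    (integrable_indicator_iff measurableSet_Iic).2 (integrableOn_exp_mul_Iic hγ s)
  have h2 := h1.convolution_integrand (ContinuousLinearMap.mul ℝ ℝ) (integrable_sinhKernel hH hH1)
  refine Integrable.mono' (h2.integrableOn.const_mul (Real.exp (γ * t)))
    (measurable_fouKernel H γ).aestronglyMeasurable ?_
  refine (ae_restrict_iff' (measurableSet_Iic.prod measurableSet_Iic)).2 (ae_of_all _ ?_)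
  rintro ⟨u, v⟩ ⟨hu, hv⟩
  rw [Real.norm_eq_abs, abs_of_nonneg (fouKernel_nonneg _ _ _ _),
    fouKernel_eq_exp_mul_sinhKernel (by linarith)]
  simp only [ContinuousLinearMap.mul_apply', Set.indicator_of_mem hv, ← mul_assoc]
  gcongr
  · exact sinhKernel_nonneg _ _
  · exact hu

theorem integrableOn_fouKernel_right {H γ : ℝ} (hH : 1 / 2 < H) (hH1 : H < 1) (hγ : 0 < γ)
    (u s : ℝ) : IntegrableOn (fun v => fouKernel H γ u v) (Set.Iic s) := by
  refine Integrable.mono' (((integrable_sinhKernel hH hH1).comp_sub_left u).integrableOn.const_mul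
    (Real.exp (γ * u) * Real.exp (γ * s)))
    ((measurable_fouKernel H γ).comp measurable_prodMk_left).aestronglyMeasurable ?_
  refine (ae_restrict_iff' measurableSet_Iic).2 (ae_of_all _ fun v hv => ?_)
  rw [Real.norm_eq_abs, abs_of_nonneg (fouKernel_nonneg _ _ _ _),
    fouKernel_eq_exp_mul_sinhKernel (by linarith)]
  gcongr
  · exact sinhKernel_nonneg _ _
  · exact hv

/-! ### The double integral for `γ = 1` -/

/-- The odd power `z ↦ |z|^p z`. -/
noncomputable def oddPow (p z : ℝ) : ℝ := |z| ^ p * z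

theorem oddPow_neg (p z : ℝ) : oddPow p (-z) = -oddPow p z := by simp [oddPow]

theorem abs_oddPow {p : ℝ} (hp : -1 < p) (z : ℝ) : |oddPow p z| = |z| ^ (p + 1) := by
  rw [oddPow, abs_mul, abs_of_nonneg (by positivity : 0 ≤ |z| ^ p)]
  rcases eq_or_ne z 0 with rfl | hz
  · rw [abs_zero, mul_zero, Real.zero_rpow (by linarith)]
  · rw [Real.rpow_add_one (abs_ne_zero.2 hz)]

theorem hasDerivAt_oddPow (p : ℝ) {z : ℝ} (hz : z ≠ 0) :
    HasDerivAt (oddPow p) ((p + 1) * |z| ^ p) z := by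
  have h1 : HasDerivAt (fun z : ℝ => |z|) (SignType.sign z : ℝ) z := hasDerivAt_abs hz
  have h2 := (h1.rpow_const (p := p) (Or.inl (abs_ne_zero.2 hz))).mul (hasDerivAt_id z)
  have hs : (SignType.sign z : ℝ) * z = |z| := sign_mul_self z
  refine HasDerivAt.congr_deriv h2 ?_
  rw [Real.rpow_sub_one (abs_ne_zero.2 hz), id, mul_one,
    show (SignType.sign z : ℝ) * p * (|z| ^ p / |z|) * z =
      (SignType.sign z : ℝ) * z * (p * (|z| ^ p / |z|)) by ring, hs]
  have := abs_ne_zero.2 hz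
  field_simp

theorem continuous_oddPow {p : ℝ} (hp : -1 < p) : Continuous (oddPow p) := by
  refine continuous_iff_continuousAt.2 fun z => ?_
  rcases eq_or_ne z 0 with rfl | hz
  · have h0 : oddPow p 0 = 0 := by simp [oddPow]
    rw [ContinuousAt, h0]
    refine squeeze_zero_norm (a := fun z => |z| ^ (p + 1))
      (fun z => by rw [Real.norm_eq_abs, abs_oddPow hp]) ?_
    have : ContinuousAt (fun z : ℝ => |z| ^ (p + 1)) 0 :=
      continuous_abs.continuousAt.rpow_const (Or.inr (by linarith))
    simpa [ContinuousAt, Real.zero_rpow (show p + 1 ≠ 0 by linarith)] using this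
  · exact (hasDerivAt_oddPow p hz).continuousAt

theorem hasDerivAt_exp_div (H u : ℝ) :
    HasDerivAt (fun u => Real.exp (u / H)) (Real.exp (u / H) / H) u := by
  simpa [div_eq_mul_inv] using ((hasDerivAt_id u).div_const H).exp

theorem tendsto_exp_div_atBot {H : ℝ} (hH : 0 < H) :
    Tendsto (fun u => Real.exp (u / H)) atBot (𝓝 0) :=
  Real.tendsto_exp_atBot.comp (tendsto_id.atBot_div_const hH)

theorem integral_Iic_of_hasDerivAt_off_countable_of_tendsto {F F' : ℝ → ℝ} {a m : ℝ} {S : Set ℝ}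
    (hS : S.Countable) (hc : Continuous F) (hd : ∀ x, x ∉ S → HasDerivAt F (F' x) x)
    (hi : IntegrableOn F' (Set.Iic a)) (hm : Tendsto F atBot (𝓝 m)) :
    ∫ x in Set.Iic a, F' x = F a - m := by
  refine tendsto_nhds_unique (intervalIntegral_tendsto_integral_Iic a hi tendsto_id) ?_
  refine (tendsto_const_nhds.sub hm).congr' ?_
  filter_upwards [Iic_mem_atBot a] with T hT
  refine (integral_eq_of_hasDerivAt_off_countable F F' hS hc.continuousOn
    (fun x hx => hd x hx.2) ?_).symm
  refine (intervalIntegrable_iff_integrableOn_Ioc_of_le hT).2 ?_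
  exact hi.mono_set Set.Ioc_subset_Iic_self

/-- For `γ = 1` the numerator is `e^{u/H} e^{v/H}`, so the kernel is a chain-rule derivative in `v`.
The antiderivative is continuous but not differentiable at `v = u`, hence the exceptional point. -/
theorem integral_fouKernel_one_right {H : ℝ} (hH : 1 / 2 < H) (hH1 : H < 1) (u q : ℝ) :
    ∫ v in Set.Iic q, fouKernel H 1 u v = H / (2 * H - 1) * Real.exp (u / H) *
      (oddPow (2 * H - 2) (Real.exp (q / H) - Real.exp (u / H)) +
        oddPow (2 * H - 2) (Real.exp (u / H))) := by
  have hH0 : 0 < H := by linarith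
  have hp : -1 < 2 * H - 2 := by linarith
  have h2 : 2 * H - 1 ≠ 0 := by linarith
  have hcont : Continuous fun v : ℝ => H / (2 * H - 1) * Real.exp (u / H) *
      oddPow (2 * H - 2) (Real.exp (v / H) - Real.exp (u / H)) :=
    continuous_const.mul ((continuous_oddPow hp).comp (by fun_prop))
  rw [integral_Iic_of_hasDerivAt_off_countable_of_tendsto (F := fun v =>
    H / (2 * H - 1) * Real.exp (u / H) *
      oddPow (2 * H - 2) (Real.exp (v / H) - Real.exp (u / H)))
    (m := H / (2 * H - 1) * Real.exp (u / H) * oddPow (2 * H - 2) (0 - Real.exp (u / H)))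
    (Set.countable_singleton u) hcont ?_
    (integrableOn_fouKernel_right hH hH1 one_pos u q) ?_]
  · rw [zero_sub, oddPow_neg]; ring
  · intro v hv
    have hne : Real.exp (v / H) - Real.exp (u / H) ≠ 0 := by
      rw [sub_ne_zero, Ne, Real.exp_eq_exp, div_left_inj' hH0.ne']
      exact hv
    have h := (((hasDerivAt_oddPow (2 * H - 2) hne).comp v
      ((hasDerivAt_exp_div H v).sub_const (Real.exp (u / H)))).const_mul
        (H / (2 * H - 1) * Real.exp (u / H)))
    refine HasDerivAt.congr_deriv h ?_
    rw [fouKernel, abs_sub_comm, div_eq_mul_inv (Real.exp ((1 - 1 + 1 / H) * (u + v))), ← Real.rpow_neg (abs_nonneg _),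
      show -(2 * (1 - H)) = 2 * H - 2 by ring, sub_self, zero_add, mul_add,
      Real.exp_add, one_div_mul_eq_div, one_div_mul_eq_div,
      show 2 * H - 2 + 1 = H * 2 - 1 by ring, show 2 * H - 1 = H * 2 - 1 by ring]
    field_simp
    rw [mul_div_cancel_left₀ _ (by linarith)]
  · exact (((continuous_oddPow hp).tendsto _).comp
      ((tendsto_exp_div_atBot hH0).sub_const _)).const_mul _

/-- The inner integral is again a chain-rule derivative, now of powers `|x|^{2H}`, which are
differentiable everywhere since `2H > 1`. -/
theorem integral_fouKernel_one {H : ℝ} (hH : 1 / 2 < H) (hH1 : H < 1) (p q : ℝ) :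
    ∫ z in Set.Iic p ×ˢ Set.Iic q, fouKernel H 1 z.1 z.2 = 1 / (2 * (2 * H - 1)) * H *
      (Real.exp (p / H) ^ (2 * H) + Real.exp (q / H) ^ (2 * H) -
        |Real.exp (p / H) - Real.exp (q / H)| ^ (2 * H)) := by
  have hH0 : 0 < H := by linarith
  have h2H : 1 < 2 * H := by linarith
  have h2 : 2 * H - 1 ≠ 0 := by linarith
  have hint := integrableOn_fouKernel hH hH1 one_pos p q
  have hint2 : IntegrableOn (fun u => H / (2 * H - 1) * Real.exp (u / H) *
      (oddPow (2 * H - 2) (Real.exp (q / H) - Real.exp (u / H)) +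
        oddPow (2 * H - 2) (Real.exp (u / H)))) (Set.Iic p) := by
    rw [IntegrableOn, Measure.volume_eq_prod, ← Measure.prod_restrict] at hint
    have := hint.integral_prod_left
    simp_rw [integral_fouKernel_one_right hH hH1] at this
    exact this
  rw [Measure.volume_eq_prod, setIntegral_prod _ hint]
  simp_rw [integral_fouKernel_one_right hH hH1]
  have habs : ∀ x : ℝ, HasDerivAt (fun x : ℝ => |x| ^ (2 * H)) (2 * H * oddPow (2 * H - 2) x) x :=
    fun x => by simpa [oddPow, mul_assoc] using hasDerivAt_abs_rpow x h2H
  have hac : Continuous fun x : ℝ => |x| ^ (2 * H) :=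
    continuous_abs.rpow_const fun _ => Or.inr (by linarith)
  rw [integral_Iic_of_hasDerivAt_off_countable_of_tendsto (F := fun u => H / (2 * (2 * H - 1)) *
      (|Real.exp (u / H)| ^ (2 * H) - |Real.exp (q / H) - Real.exp (u / H)| ^ (2 * H)))
    (m := H / (2 * (2 * H - 1)) * (|0| ^ (2 * H) - |Real.exp (q / H) - 0| ^ (2 * H)))
    Set.countable_empty ?_ ?_ hint2 ?_]
  · rw [abs_zero, Real.zero_rpow (by linarith), sub_zero, abs_of_pos (Real.exp_pos _),
      abs_of_pos (Real.exp_pos _), abs_sub_comm]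
    ring
  · exact continuous_const.mul ((hac.comp (by fun_prop)).sub (hac.comp (by fun_prop)))
  · intro u _
    have d1 := (habs _).comp u (hasDerivAt_exp_div H u)
    have d2 := (habs _).comp u ((hasDerivAt_exp_div H u).const_sub (Real.exp (q / H)))
    refine HasDerivAt.congr_deriv ((d1.sub d2).const_mul (H / (2 * (2 * H - 1)))) ?_
    field_simp
    ring
  · refine Tendsto.const_mul _ (Tendsto.sub ?_ ?_)
    · exact (hac.tendsto 0).comp (tendsto_exp_div_atBot hH0)
    · exact (hac.tendsto _).comp ((tendsto_exp_div_atBot hH0).const_sub _)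

namespace IsFractionalBrownianMotion

variable {Ω : Type*} [MeasurableSpace Ω] {P : Measure Ω} {H : ℝ} {Z : ℝ≥0 → Ω → ℝ}

theorem integral_mul_fouTimeChange (hZ : IsFractionalBrownianMotion H Z P) (hH : 1 / 2 < H)
    (hH1 : H < 1) (p q : ℝ) :
    ∫ ω, Z (fouTimeChange H p) ω * Z (fouTimeChange H q) ω ∂P =
      H * (2 * H - 1) * H ^ (2 * H - 2) *
        ∫ z in Set.Iic p ×ˢ Set.Iic q, fouKernel H 1 z.1 z.2 := by
  have hH0 : 0 < H := by linarith
  have h2 : 2 * H - 1 ≠ 0 := by linarith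
  rw [hZ.covariance, integral_fouKernel_one hH hH1, fouTimeChange, fouTimeChange,
    Real.coe_toNNReal _ (by positivity), Real.coe_toNNReal _ (by positivity), ← mul_sub, abs_mul,
    abs_of_pos hH0, Real.mul_rpow hH0.le (by positivity), Real.mul_rpow hH0.le (by positivity),
    Real.mul_rpow hH0.le (by positivity),
    show H ^ (2 * H) = H ^ (2 * H - 2) * (H * H) by
      rw [← pow_two, ← Real.rpow_natCast, ← Real.rpow_add hH0]; congr 1; push_cast; ring]
  field_simp

end IsFractionalBrownianMotion

/-! ### Almost sure limits and `L²` limits -/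

section SquareIntegrableLimits

variable {Ω : Type*} [MeasurableSpace Ω] {P : Measure Ω}

theorem inner_toLp_two {X Y : Ω → ℝ} (hX : MemLp X 2 P) (hY : MemLp Y 2 P) :
    inner ℝ (hX.toLp X) (hY.toLp Y) = ∫ ω, X ω * Y ω ∂P := by
  rw [L2.inner_def]
  refine integral_congr_ae ?_
  filter_upwards [hX.coeFn_toLp, hY.coeFn_toLp] with ω h1 h2
  rw [h1, h2, real_inner_eq_re_inner, RCLike.inner_apply]
  simp [mul_comm]

/-- A sequence that converges almost surely and whose Gram matrix converges also converges in
`L²`. -/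
theorem exists_tendsto_toLp_of_tendsto_integral_mul {X : ℕ → Ω → ℝ} {Y : Ω → ℝ}
    (hX : ∀ n, MemLp (X n) 2 P) (hXY : ∀ᵐ ω ∂P, Tendsto (fun n => X n ω) atTop (𝓝 (Y ω))) {b : ℝ}
    (hb : Tendsto (fun p : ℕ × ℕ => ∫ ω, X p.1 ω * X p.2 ω ∂P) atTop (𝓝 b)) :
    ∃ hY : MemLp Y 2 P, Tendsto (fun n => (hX n).toLp (X n)) atTop (𝓝 (hY.toLp Y)) := by
  set x : ℕ → Lp ℝ 2 P := fun n => (hX n).toLp (X n) with hx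
  have hdist : ∀ p : ℕ × ℕ, dist (x p.1) (x p.2) = Real.sqrt ((∫ ω, X p.1 ω * X p.1 ω ∂P) -
      2 * (∫ ω, X p.1 ω * X p.2 ω ∂P) + ∫ ω, X p.2 ω * X p.2 ω ∂P) := fun p => by
    rw [dist_eq_norm, ← inner_toLp_two (hX _) (hX _), ← inner_toLp_two (hX _) (hX _),
      ← inner_toLp_two (hX _) (hX _), real_inner_self_eq_norm_sq, real_inner_self_eq_norm_sq,
      ← norm_sub_sq_real, Real.sqrt_sq (norm_nonneg _)]
  have hfst : Tendsto (fun p : ℕ × ℕ => (p.1, p.1)) atTop atTop := by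
    rw [← prod_atTop_atTop_eq]; exact tendsto_fst.prodMk tendsto_fst
  have hsnd : Tendsto (fun p : ℕ × ℕ => (p.2, p.2)) atTop atTop := by
    rw [← prod_atTop_atTop_eq]; exact tendsto_snd.prodMk tendsto_snd
  have hcauchy : CauchySeq x := by
    rw [cauchySeq_iff_tendsto_dist_atTop_0]
    simp_rw [hdist]
    have := (((hb.comp hfst).sub (hb.const_mul 2)).add (hb.comp hsnd)).sqrt
    rwa [show b - 2 * b + b = 0 by ring, Real.sqrt_zero] at this
  obtain ⟨y, hy⟩ := cauchySeq_tendsto_of_complete hcauchy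
  -- Along a subsequence the `L²` limit is also an almost sure limit, so it must be `Y`.
  obtain ⟨ns, hns, hlim⟩ := (tendstoInMeasure_of_tendsto_Lp hy).exists_seq_tendsto_ae
  have hYy : (y : Ω → ℝ) =ᵐ[P] Y := by
    filter_upwards [hXY, hlim, ae_all_iff.2 fun n => (hX n).coeFn_toLp] with ω h1 h2 h3
    refine tendsto_nhds_unique h2 ((h1.comp hns.tendsto_atTop).congr fun i => ?_)
    exact (h3 (ns i)).symm
  have hY : MemLp Y 2 P := (memLp_congr_ae hYy).1 (Lp.memLp y)
  refine ⟨hY, ?_⟩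
  rwa [show hY.toLp Y = y from (Lp.ext (hY.coeFn_toLp.trans hYy.symm))]

end SquareIntegrableLimits

/-- A general filter is allowed because the Gram matrix needs `ℕ × ℕ` while the limiting covariance
needs `ℕ`. -/
theorem tendsto_integral_mul_mul_kernel {ι : Type*} {l : Filter ι} [l.IsCountablyGenerated]
    {κ : ℝ × ℝ → ℝ} (hκ : Measurable κ) (hκ0 : ∀ z, 0 ≤ κ z) {x y : ι → ℝ → ℝ} {x' y' F G : ℝ → ℝ}
    (hx : ∀ i, Measurable (x i)) (hy : ∀ i, Measurable (y i))
    (hxF : ∀ i u, |x i u| ≤ F u) (hyG : ∀ i u, |y i u| ≤ G u)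
    (hFG : Integrable fun z : ℝ × ℝ => F z.1 * (G z.2 * κ z))
    (hx' : ∀ u, Tendsto (fun i => x i u) l (𝓝 (x' u)))
    (hy' : ∀ u, Tendsto (fun i => y i u) l (𝓝 (y' u))) :
    Tendsto (fun i => ∫ z : ℝ × ℝ, x i z.1 * (y i z.2 * κ z)) l
      (𝓝 (∫ z : ℝ × ℝ, x' z.1 * (y' z.2 * κ z))) := by
  refine tendsto_integral_filter_of_dominated_convergence _ (Eventually.of_forall fun i => ?_)
    (Eventually.of_forall fun i => ae_of_all _ fun z => ?_) hFG (ae_of_all _ fun z => ?_)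
  · exact (((hx i).comp measurable_fst).mul
      (((hy i).comp measurable_snd).mul hκ)).aestronglyMeasurable
  · rw [Real.norm_eq_abs, abs_mul, abs_mul, abs_of_nonneg (hκ0 z)]
    exact mul_le_mul (hxF i _) (mul_le_mul_of_nonneg_right (hyG i _) (hκ0 z))
      (mul_nonneg (abs_nonneg _) (hκ0 z)) ((abs_nonneg _).trans (hxF i _))
  · exact (hx' _).mul ((hy' _).mul_const _)

/-- Passage to the limit in the isometry `E(X Y) = ∬ x(u) y(v) κ(u, v)` between random variables
and integrands. -/
theorem integral_mul_eq_kernel_of_tendsto {Ω ι : Type*} [MeasurableSpace Ω] {P : Measure Ω}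
    [IsProbabilityMeasure P] {κ : ℝ × ℝ → ℝ} (hκ : Measurable κ) (hκ0 : ∀ z, 0 ≤ κ z)
    {X : ι → ℕ → Ω → ℝ} {X' : ι → Ω → ℝ} {x : ι → ℕ → ℝ → ℝ} {x' F : ι → ℝ → ℝ}
    (hX : ∀ i n, MemLp (X i n) 2 P) (hX0 : ∀ i n, ∫ ω, X i n ω ∂P = 0)
    (hXX : ∀ i j n m, ∫ ω, X i n ω * X j m ω ∂P =
      ∫ z : ℝ × ℝ, x i n z.1 * (x j m z.2 * κ z))
    (hX' : ∀ i, ∀ᵐ ω ∂P, Tendsto (fun n => X i n ω) atTop (𝓝 (X' i ω)))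
    (hx : ∀ i n, Measurable (x i n)) (hxF : ∀ i n u, |x i n u| ≤ F i u)
    (hF : ∀ i j, Integrable fun z : ℝ × ℝ => F i z.1 * (F j z.2 * κ z))
    (hx' : ∀ i u, Tendsto (fun n => x i n u) atTop (𝓝 (x' i u))) :
    (∀ i, MemLp (X' i) 2 P ∧ ∫ ω, X' i ω ∂P = 0) ∧
    ∀ i j, ∫ ω, X' i ω * X' j ω ∂P = ∫ z : ℝ × ℝ, x' i z.1 * (x' j z.2 * κ z) := by
  have hfst : Tendsto (Prod.fst : ℕ × ℕ → ℕ) atTop atTop := by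
    rw [← prod_atTop_atTop_eq]; exact tendsto_fst
  have hsnd : Tendsto (Prod.snd : ℕ × ℕ → ℕ) atTop atTop := by
    rw [← prod_atTop_atTop_eq]; exact tendsto_snd
  have key := fun i => exists_tendsto_toLp_of_tendsto_integral_mul (hX i) (hX' i)
    (b := ∫ z : ℝ × ℝ, x' i z.1 * (x' i z.2 * κ z)) (by
      simp_rw [hXX]
      exact tendsto_integral_mul_mul_kernel (x := fun p : ℕ × ℕ => x i p.1)
        (y := fun p : ℕ × ℕ => x i p.2) hκ hκ0 (fun p => hx i _) (fun p => hx i _)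
        (fun p => hxF i _) (fun p => hxF i _) (hF i i) (fun u => (hx' i u).comp hfst)
        (fun u => (hx' i u).comp hsnd))
  choose hY hlim using key
  refine ⟨fun i => ⟨hY i, ?_⟩, fun i j => ?_⟩
  -- The mean is the inner product with the constant `1`, hence `L²`-continuous.
  · have h1 : MemLp (fun _ : Ω => (1 : ℝ)) 2 P := memLp_const 1
    have h2 := (hlim i).inner (𝕜 := ℝ) (tendsto_const_nhds (x := h1.toLp _))
    simp only [inner_toLp_two, mul_one, hX0] at h2
    exact (tendsto_nhds_unique h2 tendsto_const_nhds)
  · have h2 := (hlim i).inner (𝕜 := ℝ) (hlim j)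
    simp only [inner_toLp_two, hXX] at h2
    exact tendsto_nhds_unique h2 (tendsto_integral_mul_mul_kernel hκ hκ0 (hx i) (hx j) (hxF i)
      (hxF j) (hF i j) (hx' i) (hx' j))

/-! ### Left sums of random variables and of indicators -/

section LeftSum

variable {α : Type*} [MeasurableSpace α] {μ : Measure α}

theorem leftSum_mul_const (f g : ℝ → ℝ) (a b : ℝ) (n : ℕ) (c : ℝ) :
    leftSum f g a b n * c = leftSum f (fun p => g p * c) a b n := by
  simp only [leftSum, Finset.sum_mul]
  exact Finset.sum_congr rfl fun i _ => by ring

theorem const_mul_leftSum (f g : ℝ → ℝ) (a b : ℝ) (n : ℕ) (c : ℝ) :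
    c * leftSum f g a b n = leftSum f (fun p => c * g p) a b n := by
  simp only [leftSum, Finset.mul_sum]
  exact Finset.sum_congr rfl fun i _ => by ring

theorem integrable_leftSum {f : ℝ → ℝ} {G : ℝ → α → ℝ} (hG : ∀ p, Integrable (G p) μ)
    (a b : ℝ) (n : ℕ) : Integrable (fun z => leftSum f (fun p => G p z) a b n) μ :=
  integrable_finsetSum _ fun _ _ => ((hG _).sub (hG _)).const_mul _

theorem integral_leftSum {f : ℝ → ℝ} {G : ℝ → α → ℝ} (hG : ∀ p, Integrable (G p) μ)
    (a b : ℝ) (n : ℕ) : ∫ z, leftSum f (fun p => G p z) a b n ∂μ =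
      leftSum f (fun p => ∫ z, G p z ∂μ) a b n := by
  simp only [leftSum]
  have h : ∀ c p q, Integrable (fun z => c * (G p z - G q z)) μ := fun c p q =>
    ((hG p).sub (hG q)).const_mul c
  rw [integral_finsetSum _ fun _ _ => h _ _ _]
  exact Finset.sum_congr rfl fun i _ => by rw [integral_const_mul, integral_sub (hG _) (hG _)]

/-- The measure space is arbitrary so that the identity serves both on `Ω`, for the process, and on
the plane, for indicators weighted by the kernel. -/
theorem integral_leftSum_mul_leftSum {f f' : ℝ → ℝ} {G G' : ℝ → α → ℝ}
    (hG : ∀ p q, Integrable (fun z => G p z * G' q z) μ) (a b a' b' : ℝ) (n n' : ℕ) :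
    ∫ z, leftSum f (fun p => G p z) a b n * leftSum f' (fun q => G' q z) a' b' n' ∂μ =
      leftSum f (fun p => leftSum f' (fun q => ∫ z, G p z * G' q z ∂μ) a' b' n') a b n := by
  simp_rw [leftSum_mul_const, const_mul_leftSum]
  rw [integral_leftSum fun p => integrable_leftSum (hG p) a' b' n']
  simp_rw [integral_leftSum (hG _)]

theorem memLp_leftSum {f : ℝ → ℝ} {G : ℝ → α → ℝ} (hG : ∀ p, MemLp (G p) 2 μ)
    (a b : ℝ) (n : ℕ) : MemLp (fun z => leftSum f (fun p => G p z) a b n) 2 μ :=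
  memLp_finsetSum _ fun _ _ => ((hG _).sub (hG _)).const_mul _

/-- The indicator function of `(-∞, p]`, evaluated at `u`. -/
noncomputable def stepFun (p u : ℝ) : ℝ := (Set.Iic p).indicator 1 u

theorem measurable_stepFun (p : ℝ) : Measurable (stepFun p) :=
  measurable_one.indicator measurableSet_Iic

theorem stepFun_nonneg (p u : ℝ) : 0 ≤ stepFun p u :=
  Set.indicator_nonneg (fun _ _ => zero_le_one) u

theorem stepFun_of_le {p u : ℝ} (h : u ≤ p) : stepFun p u = 1 :=
  Set.indicator_of_mem (s := Set.Iic p) h _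

theorem stepFun_of_lt {p u : ℝ} (h : p < u) : stepFun p u = 0 :=
  Set.indicator_of_notMem (s := Set.Iic p) (not_le.2 h) _

theorem stepFun_mono {p q : ℝ} (h : p ≤ q) (u : ℝ) : stepFun p u ≤ stepFun q u :=
  Set.indicator_le_indicator_of_subset (Set.Iic_subset_Iic.2 h) (fun _ => zero_le_one) u

theorem measurable_leftSum_stepFun (f : ℝ → ℝ) (a b : ℝ) (n : ℕ) :
    Measurable fun u => leftSum f (fun p => stepFun p u) a b n :=
  Finset.measurable_sum _ fun _ _ =>
    ((measurable_stepFun _).sub (measurable_stepFun _)).const_mul _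

/-- The increments of `p ↦ stepFun p u` are nonnegative and telescope. -/
theorem abs_leftSum_stepFun_le {f : ℝ → ℝ} {a b M : ℝ} (hab : a ≤ b)
    (hM : ∀ s ∈ Set.Icc a b, |f s| ≤ M) (n : ℕ) (u : ℝ) :
    |leftSum f (fun p => stepFun p u) a b n| ≤ M * stepFun b u := by
  have hM0 : 0 ≤ M := (abs_nonneg _).trans (hM a ⟨le_rfl, hab⟩)
  rcases eq_or_ne n 0 with rfl | hn
  · simpa [leftSum] using mul_nonneg hM0 (stepFun_nonneg b u)
  have hmem := mem_Icc_of_partition (uniformPartition_zero a b n) (uniformPartition_self a b hn)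
    fun i _ => uniformPartition_mono hab n i
  calc _ ≤ _ := Finset.abs_sum_le_sum_abs _ _
    _ ≤ ∑ i ∈ Finset.range n, M * (stepFun (uniformPartition a b n (i + 1)) u -
          stepFun (uniformPartition a b n i) u) := by
      refine Finset.sum_le_sum fun i hi => ?_
      have h0 := sub_nonneg.2 (stepFun_mono (uniformPartition_mono hab n i) u)
      rw [abs_mul, abs_of_nonneg h0]
      exact mul_le_mul_of_nonneg_right (hM _ (hmem i (Finset.mem_range.1 hi).le)) h0
    _ = M * (stepFun b u - stepFun a u) := by
      rw [← Finset.mul_sum, Finset.sum_range_sub (fun i => stepFun (uniformPartition a b n i) u),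
        uniformPartition_zero, uniformPartition_self a b hn]
    _ ≤ _ := mul_le_mul_of_nonneg_left (sub_le_self _ (stepFun_nonneg a u)) hM0

/-- Only a cell containing `u` contributes, and there the tag is within the mesh of `u`. -/
theorem tendsto_leftSum_stepFun {f : ℝ → ℝ} (hf : Continuous f) {a b : ℝ} (hab : a ≤ b) (u : ℝ) :
    Tendsto (leftSum f (fun p => stepFun p u) a b) atTop
      (𝓝 (f u * (stepFun b u - stepFun a u))) := by
  rw [Metric.tendsto_atTop]
  intro ε hε
  obtain ⟨δ, hδ, hfδ⟩ := Metric.continuous_iff.1 hf u (ε / 2) (half_pos hε)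
  have ht : Tendsto (fun n : ℕ => (b - a) / n) atTop (𝓝 0) :=
    tendsto_const_div_atTop_nhds_zero_nat _
  obtain ⟨N, hN⟩ := eventually_atTop.1 (ht.eventually_lt_const hδ)
  refine ⟨N + 1, fun n hn => ?_⟩
  have hn0 : n ≠ 0 := by omega
  have htel : stepFun b u - stepFun a u = ∑ i ∈ Finset.range n,
      (stepFun (uniformPartition a b n (i + 1)) u - stepFun (uniformPartition a b n i) u) := by
    rw [Finset.sum_range_sub (fun i => stepFun (uniformPartition a b n i) u),
      uniformPartition_zero, uniformPartition_self a b hn0]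
  have hle : stepFun b u - stepFun a u ≤ 1 := by
    have : stepFun b u ≤ 1 := Set.indicator_le_self' (fun _ _ => zero_le_one) u
    linarith [stepFun_nonneg a u]
  rw [Real.dist_eq]
  calc _ = |∑ i ∈ Finset.range n, (f (uniformPartition a b n i) - f u) *
        (stepFun (uniformPartition a b n (i + 1)) u - stepFun (uniformPartition a b n i) u)| := by
        simp_rw [sub_mul (f _)]
        rw [Finset.sum_sub_distrib, ← Finset.mul_sum, ← htel, leftSum]
    _ ≤ _ := Finset.abs_sum_le_sum_abs _ _
    _ ≤ ∑ i ∈ Finset.range n, ε / 2 * (stepFun (uniformPartition a b n (i + 1)) u -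
          stepFun (uniformPartition a b n i) u) := by
      refine Finset.sum_le_sum fun i hi => ?_
      have h0 := sub_nonneg.2 (stepFun_mono (uniformPartition_mono hab n i) u)
      rw [abs_mul, abs_of_nonneg h0]
      rcases le_or_gt u (uniformPartition a b n i) with h1 | h1
      · rw [stepFun_of_le h1, stepFun_of_le (h1.trans (uniformPartition_mono hab n i))]; simp
      rcases lt_or_ge (uniformPartition a b n (i + 1)) u with h2 | h2
      · rw [stepFun_of_lt h1, stepFun_of_lt h2]; simp
      refine mul_le_mul_of_nonneg_right (hfδ _ ?_).le h0
      have h3 := uniformPartition_succ_sub a b n i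
      have h4 := hN n (by omega)
      rw [Real.dist_eq, abs_lt]
      constructor <;> linarith
    _ = ε / 2 * (stepFun b u - stepFun a u) := by rw [← Finset.mul_sum, htel]
    _ < ε := by nlinarith

end LeftSum

theorem stepFun_mul_stepFun_mul (p q : ℝ) (κ : ℝ × ℝ → ℝ) :
    (fun z : ℝ × ℝ => stepFun p z.1 * (stepFun q z.2 * κ z)) =
      (Set.Iic p ×ˢ Set.Iic q).indicator κ := by
  funext z
  by_cases h1 : z.1 ≤ p
  · by_cases h2 : z.2 ≤ q
    · rw [stepFun_of_le h1, stepFun_of_le h2, one_mul, one_mul, Set.indicator_of_mem (show z ∈ Set.Iic p ×ˢ Set.Iic q from ⟨h1, h2⟩)]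
    · rw [stepFun_of_lt (not_le.1 h2), zero_mul, mul_zero,
        Set.indicator_of_notMem fun h => h2 h.2]
  · rw [stepFun_of_lt (not_le.1 h1), zero_mul, Set.indicator_of_notMem fun h => h1 h.1]

theorem integral_stepFun_mul (p q : ℝ) (κ : ℝ × ℝ → ℝ) :
    ∫ z : ℝ × ℝ, stepFun p z.1 * (stepFun q z.2 * κ z) =
      ∫ z in Set.Iic p ×ˢ Set.Iic q, κ z := by
  rw [stepFun_mul_stepFun_mul, integral_indicator (measurableSet_Iic.prod measurableSet_Iic)]

theorem integrable_stepFun_mul {p q : ℝ} {κ : ℝ × ℝ → ℝ}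
    (h : IntegrableOn κ (Set.Iic p ×ˢ Set.Iic q)) :
    Integrable fun z : ℝ × ℝ => stepFun p z.1 * (stepFun q z.2 * κ z) := by
  rw [stepFun_mul_stepFun_mul, integrable_indicator_iff (measurableSet_Iic.prod measurableSet_Iic)]
  exact h

theorem volume_restrict_Iio_prod_Iio (t s : ℝ) :
    (volume : Measure (ℝ × ℝ)).restrict (Set.Iio t ×ˢ Set.Iio s) =
      volume.restrict (Set.Iic t ×ˢ Set.Iic s) := by
  rw [Measure.volume_eq_prod, ← Measure.prod_restrict, ← Measure.prod_restrict,
    Measure.restrict_congr_set Iio_ae_eq_Iic, Measure.restrict_congr_set Iio_ae_eq_Iic]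

theorem continuous_fouTimeChange (H : ℝ) : Continuous (fouTimeChange H) :=
  continuous_real_toNNReal.comp (by fun_prop)

/-! ### Existence and covariance of the improper integrals -/

namespace IsFractionalBrownianMotion

variable {Ω : Type*} [MeasurableSpace Ω] {P : Measure Ω} {H : ℝ} {Z : ℝ≥0 → Ω → ℝ}

theorem ae_exists_hasImproperRSIntegral (hZ : IsFractionalBrownianMotion H Z P) (hH : 1 / 2 < H)
    {γ : ℝ} (hγ : 0 < γ) :
    ∀ᵐ ω ∂P, ∀ t : ℝ, ∃ L : ℝ, HasImproperRSIntegral (fun s => Real.exp ((γ - 1) * s))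
      (fun s => Z (fouTimeChange H s) ω) t L := by
  -- The choice `β = 1 - min (γ/2) 1` satisfies both `0 ≤ β < 1` and `γ - 1 + β > 0`.
  have hmin : 0 < min (γ / 2) 1 := lt_min (half_pos hγ) one_pos
  have h1 : min (γ / 2) 1 ≤ 1 := min_le_right _ _
  have h2 : min (γ / 2) 1 ≤ γ / 2 := min_le_left _ _
  filter_upwards [hZ.ae_abs_le_exp hH (β := 1 - min (γ / 2) 1) (by linarith) (by linarith),
    hZ.continuous_paths] with ω ⟨C, hC⟩ hc t
  exact ⟨_, hasImproperRSIntegral_exp (hc.comp (continuous_fouTimeChange H)) (by linarith) hC t⟩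

/-- The integrals `∫_{-∞}^t e^{(γ-1)s} dZ_{a_s}` are centred and square integrable, and their
covariance is the integral of the kernel. -/
theorem integral_improperRSIntegral_mul [IsProbabilityMeasure P]
    (hZ : IsFractionalBrownianMotion H Z P) (hH : 1 / 2 < H) (hH1 : H < 1) {γ : ℝ} (hγ : 0 < γ) :
    (∀ t, MemLp (fun ω => improperRSIntegral (fun s => Real.exp ((γ - 1) * s))
        (fun s => Z (fouTimeChange H s) ω) t) 2 P ∧
      ∫ ω, improperRSIntegral (fun s => Real.exp ((γ - 1) * s))
        (fun s => Z (fouTimeChange H s) ω) t ∂P = 0) ∧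
    ∀ t s, ∫ ω, improperRSIntegral (fun s => Real.exp ((γ - 1) * s))
        (fun s => Z (fouTimeChange H s) ω) t * improperRSIntegral
          (fun s => Real.exp ((γ - 1) * s)) (fun s => Z (fouTimeChange H s) ω) s ∂P =
      H * (2 * H - 1) * H ^ (2 * H - 2) *
        ∫ z in Set.Iic t ×ˢ Set.Iic s, fouKernel H γ z.1 z.2 := by
  have hH0 : 0 < H := by linarith
  set f : ℝ → ℝ := fun s => Real.exp ((γ - 1) * s) with hf
  set f' : ℝ → ℝ := fun s => Real.exp ((γ - 1) * s) * (γ - 1) with hf'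
  have hfd : ∀ s, HasDerivAt f (f' s) s := fun s => by
    simpa [hf, hf'] using ((hasDerivAt_id s).const_mul (γ - 1)).exp
  have hfc : Continuous f := by fun_prop
  have hf'c : Continuous f' := by fun_prop
  set W : ℝ → Ω → ℝ := fun s ω => Z (fouTimeChange H s) ω with hW
  have hW2 : ∀ p, MemLp (W p) 2 P := fun p => hZ.memLp_two _
  set c : ℝ := H * (2 * H - 1) * H ^ (2 * H - 2) with hc
  have hc0 : 0 ≤ c := by
    have : 0 ≤ 2 * H - 1 := by linarith
    positivity
  set κ : ℝ × ℝ → ℝ := fun z => c * fouKernel H 1 z.1 z.2 with hκdef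
  have hκ : Measurable κ := (measurable_fouKernel H 1).const_mul c
  have hκ0 : ∀ z, 0 ≤ κ z := fun z => mul_nonneg hc0 (fouKernel_nonneg _ _ _ _)
  have hκi : ∀ p q, Integrable fun z : ℝ × ℝ => stepFun p z.1 * (stepFun q z.2 * κ z) :=
    fun p q => integrable_stepFun_mul ((integrableOn_fouKernel hH hH1 one_pos p q).const_mul c)
  have hcov : ∀ p q, ∫ ω, W p ω * W q ω ∂P =
      ∫ z : ℝ × ℝ, stepFun p z.1 * (stepFun q z.2 * κ z) := fun p q => by
    rw [integral_stepFun_mul, integral_const_mul]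
    exact hZ.integral_mul_fouTimeChange hH hH1 p q
  have hle : ∀ (t : ℝ) (N : ℕ), t - N ≤ t := fun t N => sub_le_self _ N.cast_nonneg
  have hbound : ∀ i : ℝ × ℕ, ∃ M, ∀ s ∈ Set.Icc (i.1 - i.2) i.1, |f s| ≤ M := fun i =>
    isCompact_Icc.exists_bound_of_continuousOn hfc.continuousOn
  choose M hM using hbound
  set J : ℝ × ℕ → Ω → ℝ := fun i ω => f i.1 * W i.1 ω - f (i.1 - i.2) * W (i.1 - i.2) ω -
    ∫ s in (i.1 - i.2)..i.1, W s ω * f' s with hJ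
  have hJR : ∀ᵐ ω ∂P, ∀ i : ℝ × ℕ,
      HasRiemannStieltjesIntegral f (fun s => W s ω) (i.1 - i.2) i.1 (J i ω) := by
    filter_upwards [hZ.continuous_paths] with ω hω i
    exact hasRiemannStieltjesIntegral_of_hasDerivAt hfd hf'c
      (hω.comp (continuous_fouTimeChange H)) (hle _ _)
  -- The mesh tends to zero on `[t - N, t]`. Indexing by pairs `(t, N)` also yields the covariances
  -- between different endpoints, which the next passage to the limit takes as input.
  have finite_stage := integral_mul_eq_kernel_of_tendsto (P := P) (ι := ℝ × ℕ) hκ hκ0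
    (X := fun i n ω => leftSum f (fun p => W p ω) (i.1 - i.2) i.1 n) (X' := J)
    (x := fun i n u => leftSum f (fun p => stepFun p u) (i.1 - i.2) i.1 n)
    (x' := fun i u => f u * (stepFun i.1 u - stepFun (i.1 - i.2) u))
    (F := fun i u => M i * stepFun i.1 u)
    (fun i n => memLp_leftSum hW2 _ _ _)
    (fun i n => by
      rw [integral_leftSum fun p => (hW2 p).integrable one_le_two]
      simp only [hW, hZ.centered]
      simp [leftSum])
    (fun i j n m => by
      rw [integral_leftSum_mul_leftSum fun p q => (hW2 p).integrable_mul (hW2 q)]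
      simp_rw [hcov, leftSum_mul_const]
      -- The same bilinear expansion, read backwards on the plane.
      exact (integral_leftSum_mul_leftSum (G := fun p (z : ℝ × ℝ) => stepFun p z.1)
        (G' := fun q z => stepFun q z.2 * κ z) hκi _ _ _ _ n m).symm.trans
          (by simp_rw [leftSum_mul_const]))
    (fun i => hJR.mono fun ω hω => (hω i).tendsto_leftSum (hle _ _))
    (fun i n => measurable_leftSum_stepFun _ _ _ _)
    (fun i n u => abs_leftSum_stepFun_le (hle _ _) (hM i) n u)
    (fun i j => ((hκi i.1 j.1).const_mul (M i * M j)).congr (ae_of_all _ fun z => by ring))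
    (fun i u => tendsto_leftSum_stepFun hfc (hle _ _) u)
  -- Since `e^{γu} = f(u) e^u`, the weights `f(u) f(v)` turn the kernel for `1` into the kernel for
  -- `γ`.
  have hkernel : ∀ t s, (fun z : ℝ × ℝ => f z.1 * stepFun t z.1 * (f z.2 * stepFun s z.2 * κ z)) =
      fun z => stepFun t z.1 * (stepFun s z.2 * (c * fouKernel H γ z.1 z.2)) := fun t s => by
    funext z
    have e : ∀ u, Real.exp (γ * u) = f u * Real.exp (1 * u) := fun u => by
      rw [hf, ← Real.exp_add]; congr 1; ring
    simp only [hκdef]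
    rw [fouKernel_eq_exp_mul_sinhKernel hH0, fouKernel_eq_exp_mul_sinhKernel hH0, e, e]
    ring
  -- Now `N → ∞`. The integrands are dominated by their own limit `f · stepFun t`, and at each `u`
  -- they are eventually equal to it.
  have limit_stage := integral_mul_eq_kernel_of_tendsto (P := P) (ι := ℝ) hκ hκ0
    (X := fun t N => J (t, N)) (X' := fun t ω => improperRSIntegral f (fun s => W s ω) t)
    (x := fun t N u => f u * (stepFun t u - stepFun (t - N) u))
    (x' := fun t u => f u * stepFun t u) (F := fun t u => f u * stepFun t u)
    (fun t N => (finite_stage.1 (t, N)).1) (fun t N => (finite_stage.1 (t, N)).2)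
    (fun t s N N' => finite_stage.2 (t, N) (s, N'))
    (fun t => by
      filter_upwards [hJR, hZ.ae_exists_hasImproperRSIntegral hH hγ] with ω hω hL
      obtain ⟨L, hL⟩ := hL t
      rw [hL.improperRSIntegral_eq]
      obtain ⟨I, hI, hlim⟩ := hL
      have hT : Tendsto (fun N : ℕ => t - (N : ℝ)) atTop atBot :=
        tendsto_const_nhds.add_atBot (tendsto_neg_atTop_atBot.comp tendsto_natCast_atTop_atTop)
      refine (hlim.comp hT).congr' ?_
      -- `N = 0` is discarded because the improper integral only prescribes values for `T < t`;
      -- elsewhere uniqueness identifies them with `J`.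
      filter_upwards [eventually_gt_atTop 0] with N hN
      have hlt : t - (N : ℝ) < t := sub_lt_self _ (Nat.cast_pos.2 hN)
      exact tendsto_nhds_unique ((hI _ hlt).tendsto_leftSum hlt.le)
        ((hω (t, N)).tendsto_leftSum hlt.le))
    (fun t N => hfc.measurable.mul ((measurable_stepFun _).sub (measurable_stepFun _)))
    (fun t N u => by
      have h0 := sub_nonneg.2 (stepFun_mono (hle t N) u)
      rw [abs_mul, abs_of_pos (Real.exp_pos _), abs_of_nonneg h0]
      exact mul_le_mul_of_nonneg_left (sub_le_self _ (stepFun_nonneg _ u)) (Real.exp_pos _).le)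
    (fun t s => by
      rw [hkernel]
      exact integrable_stepFun_mul ((integrableOn_fouKernel hH hH1 hγ t s).const_mul c))
    (fun t u => by
      obtain ⟨N₀, hN₀⟩ := exists_nat_gt (t - u)
      refine tendsto_const_nhds.congr' ?_
      filter_upwards [eventually_ge_atTop N₀] with N hN
      have : (N₀ : ℝ) ≤ N := Nat.cast_le.2 hN
      rw [stepFun_of_lt (p := t - N) (by linarith), sub_zero])
  refine ⟨limit_stage.1, fun t s => (limit_stage.2 t s).trans ?_⟩
  rw [hkernel, integral_stepFun_mul, integral_const_mul]

end IsFractionalBrownianMotion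

theorem propositionp11 {Ω : Type*} [MeasurableSpace Ω] (P : Measure Ω) [IsProbabilityMeasure P]
    (H γ : ℝ) (hH : 1 / 2 < H) (hH1 : H < 1) (hγ : 0 < γ)
    (Z : ℝ≥0 → Ω → ℝ) (hZ : IsFractionalBrownianMotion H Z P) :
    (∀ᵐ ω ∂P, ∀ t : ℝ, ∃ L : ℝ, HasImproperRSIntegral (fun s => Real.exp ((γ - 1) * s))
        (fun s => Z (fouTimeChange H s) ω) t L) ∧
    (∀ t : ℝ, MemLp (fouSecondKind H γ Z t) 2 P ∧ ∫ ω, fouSecondKind H γ Z t ω ∂P = 0) ∧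
    (∀ t s : ℝ,
      IntegrableOn (fun p : ℝ × ℝ => fouKernel H γ p.1 p.2) (Set.Iio t ×ˢ Set.Iio s) ∧
      ∫ ω, fouSecondKind H γ Z t ω * fouSecondKind H γ Z s ω ∂P =
        H * (2 * H - 1) * H ^ (2 * H - 2) * Real.exp (-γ * (t + s)) *
          ∫ p in Set.Iio t ×ˢ Set.Iio s, fouKernel H γ p.1 p.2) := by
  obtain ⟨hmean, hcov⟩ := hZ.integral_improperRSIntegral_mul hH hH1 hγ
  refine ⟨hZ.ae_exists_hasImproperRSIntegral hH hγ, fun t => ⟨(hmean t).1.const_mul _, ?_⟩,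
    fun t s => ⟨?_, ?_⟩⟩
  · simp only [fouSecondKind]
    rw [integral_const_mul, (hmean t).2, mul_zero]
  · rw [IntegrableOn, volume_restrict_Iio_prod_Iio]
    exact integrableOn_fouKernel hH hH1 hγ t s
  · have e : ∀ ω, fouSecondKind H γ Z t ω * fouSecondKind H γ Z s ω = Real.exp (-γ * (t + s)) *
        (improperRSIntegral (fun s => Real.exp ((γ - 1) * s))
          (fun s => Z (fouTimeChange H s) ω) t *
        improperRSIntegral (fun s => Real.exp ((γ - 1) * s))
          (fun s => Z (fouTimeChange H s) ω) s) := fun ω => by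
      rw [mul_add, Real.exp_add, fouSecondKind, fouSecondKind]; ring
    simp_rw [e]
    rw [integral_const_mul, hcov, volume_restrict_Iio_prod_Iio]
    ring
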